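/- Let $R$ be a ring with $1$ and $M$ a left $R$-module that is both Artinian and Noetherian. Let $N\subsetneq K\subsetneq L\subseteq M$ be submodules such that $E=L/N$ is indecomposable of composition length $2$, and put $A=L/K$, $B=K/N$. Conventions. A constituent of $M$ is a subquotient $P=U/V$ with $V\subseteq U\subseteq M$, recorded by the pair $(V,U)$. Virtual equality $\widehat{=}$ of constituents is the equivalence relation generated by $(U+V)/V\;\widehat{=}\;U/(U\cap V)$. The ordering $\lessdot$ ("is enclosed by") is the reflexive and transitive relation generated by $\widehat{=}$ and by $P\lessdot Q$ whenever $P$ is a subquotient of $Q$ not occurring as a direct summand, i.e. there is no decomposition $Q=D\oplus C$ in which the subquotient map carries $D$ isomorphically onto $P$. Let $\operatorname{rad}^0M=M$ and $\operatorname{rad}^{i+1}M=\operatorname{rad}(\operatorname{rad}^iM)$, and let $0=S_0(M)\subseteq S_1(M)\subseteq\cdots$ be the socle series. The constituent $E=L/N$ meets the $i$-th radical layer ($i\ge1$) if $N+(L\cap\operatorname{rad}^{i}M)\ne N+(L\cap\operatorname{rad}^{i-1}M)$, and it meets the $i$-th socle layer if $N+(L\cap S_i(M))\neq N+(L\cap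 S_{i-1}(M))$. The Loewy length of a module $Z$ is the least $n$ with $\operatorname{rad}^nZ=0$. A quotient $M/X$ is a maximal-depth $E$-enclosing quotient if $E\lessdot M/X$ and its Loewy length is the largest $i$ such that $E$ meets the $i$-th radical layer of $M$. A submodule $Y\subseteq M$ is a maximal-depth $E$-enclosing submodule if $E\lessdot Y$ and its Loewy length is the largest $i$ such that $E$ meets the $i$-th socle layer of $M$. (1) Let $\mathcal X$ be the set of submodules $X\subseteq M$ such that $M/X$ is a maximal-depth $E$-enclosing quotient of $M$, $L\cap X=N$ (so that $E\;\widehat{=}\;(L+X)/X$ is a submodule of $M/X$), and there are an injective hull $j\colon B\to I_B$ and an injective homomorphism $M/X\to I_B$ which restricts to $j$ on $B\;\widehat{=}\;(K+X)/X$ (so that $E\subseteq M/X\subseteq I_B$). Then $\mathcal X$ is non-empty; there is $X\in\mathcal X$ such that $M/X$ is $\lessdot$-maximal among the quotients $M/X'$ with $X'\in\mathcal X$ (that is, $M/X\lessdot M/X'$ implies $M/X\;\widehat{=}\;M/X'$); and $M/X$ is indecomposable for every $X\in\mathcal X$. (2) Assume that $A$ has a projective cover or that $R$ is left Artinian. Let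 $\mathcal Y$ be the set of submodules $Y\subseteq M$ such that $Y$ is a maximal-depth $E$-enclosing submodule of $M$, $Y+N=L$ (so that $E\;\widehat{=}\;Y/(Y\cap N)$ is a quotient of $Y$), and there are a projective cover $p\colon P_A\to A$ and a surjective homomorphism $P_A\to Y$ whose composite with $Y\to L/K=A$ is $p$ (so that $E$ is a quotient of $Y$ and $Y$ a quotient of $P_A$). Then $\mathcal Y$ is non-empty; there is $Y\in\mathcal Y$ that is $\lessdot$-maximal in $\mathcal Y$ (that is, $Y\lessdot Y'$ with $Y'\in\mathcal Y$ implies $Y\;\widehat{=}\;Y'$); and every $Y\in\mathcal Y$ is indecomposable. -/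

import Mathlib

namespace VirtualExt

universe u v w

section General

variable (R : Type u) [Ring R] (M : Type v) [AddCommGroup M] [Module R M]

/-- The radical powers `rad^i M`: `rad^0 M = M`, and `rad^(i+1) M` is the radical (intersection of
all maximal submodules) of the module `rad^i M`, regarded as a submodule of `M`. -/
noncomputable def radPow : ℕ → Submodule R M
  | 0 => ⊤
  | i + 1 => (Module.jacobson R ↥(radPow i)).map (radPow i).subtype

/-- The socle: the sum of all simple submodules. -/
def socle : Submodule R M :=
  sSup {S : Submodule R M | IsSimpleModule R ↥S}

/-- The socle series `S_i(M)`: `S_0(M) = 0`, and `S_(i+1)(M)` is the preimage in `M` of the socle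
of `M / S_i(M)`. -/
noncomputable def socPow : ℕ → Submodule R M
  | 0 => ⊥
  | i + 1 => (socle R (M ⧸ socPow i)).comap (socPow i).mkQ

/-- `M` has Loewy length `d`: `d` is the least natural number with `rad^d M = 0`. -/
def HasLoewyLength (d : ℕ) : Prop :=
  IsLeast {i : ℕ | radPow R M i = ⊥} d

/-- An indecomposable module: nonzero, without a nontrivial direct sum decomposition. -/
def Indecomposable : Prop :=
  Nontrivial M ∧ ∀ P Q : Submodule R M, IsCompl P Q → P = ⊥ ∨ Q = ⊥

variable {R M}

/-- `j : B → I` is an injective hull of `B`: `I` is an injective module and `j` is an injective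
map with essential image. -/
def IsInjectiveHull {B : Type v} [AddCommGroup B] [Module R B]
    {I : Type w} [AddCommGroup I] [Module R I] (j : B →ₗ[R] I) : Prop :=
  Module.Injective R I ∧ Function.Injective j ∧
    ∀ U : Submodule R I, U ⊓ LinearMap.range j = ⊥ → U = ⊥

/-- `p : P → A` is a projective cover of `A`: `P` is a projective module and `p` is a surjective
map with superfluous kernel. -/
def IsProjectiveCover {A : Type v} [AddCommGroup A] [Module R A]
    {P : Type w} [AddCommGroup P] [Module R P] (p : P →ₗ[R] A) : Prop :=
  Module.Projective R P ∧ Function.Surjective p ∧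
    ∀ U : Submodule R P, U ⊔ LinearMap.ker p = ⊤ → U = ⊤

/-- The module `A` has a projective cover. -/
def HasProjectiveCover (R : Type u) [Ring R] (A : Type v) [AddCommGroup A] [Module R A] : Prop :=
  ∃ (P : Type (max u v)) (_ : AddCommGroup P) (_ : Module R P) (p : P →ₗ[R] A),
    IsProjectiveCover p

end General

/-- A subquotient `upper / lower` of `M`, given by the two submodules themselves (not up to
isomorphism). A submodule of a subquotient of `M`, and a subquotient of a subquotient of `M`, is
again of this form, by the correspondence between submodules of `L / N` and submodules of `M`
between `N` and `L`. -/
structure Constituent (R : Type u) [Ring R] (M : Type v) [AddCommGroup M] [Module R M] where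
  lower : Submodule R M
  upper : Submodule R M
  le : lower ≤ upper

namespace Constituent

variable {R : Type u} [Ring R] {M : Type v} [AddCommGroup M] [Module R M]

/-- The subquotient `L / N`, for `N ≤ L`. -/
def of (N L : Submodule R M) (h : N ≤ L) : Constituent R M := ⟨N, L, h⟩

/-- The quotient `M / X` as a constituent of `M`. -/
def quot (X : Submodule R M) : Constituent R M := ⟨X, ⊤, le_top⟩

/-- The submodule `Y` as a constituent of `M`. -/
def sub (Y : Submodule R M) : Constituent R M := ⟨⊥, Y, bot_le⟩

/-- Equality in the virtual category: the equivalence relation generated by identifying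
`(A + B) / B` with `A / (A ∩ B)`. The other identifications that define the virtual category need
no separate clause for subquotients recorded as pairs of submodules of `M`:
`A / B` and `(A / C) / (B / C)` are the same pair, and so are `C` as a submodule of `B` and `C` as a
submodule of `A` for `C ⊆ B ⊆ A`; a submodule `V₀` of `V` with `V₀ ∩ W = 0` is identified with its
image `(V₀ + W) / W` in `V / W`, which is the case `A = V₀`, `B = W`; and the summands `M_i / S_i` of
`(⨁ M_i) / (⨁ S_i)` are identified with `(M_i + ⨁ S_k) / ⨁ S_k`, which is the case
`A = M_i`, `B = ⨁ S_k`. -/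
def VirtEq : Constituent R M → Constituent R M → Prop :=
  Relation.EqvGen fun P Q =>
    ∃ A B : Submodule R M, P = ⟨B, A ⊔ B, le_sup_right⟩ ∧ Q = ⟨A ⊓ B, A, inf_le_left⟩

/-- `P` is a subquotient of `Q`, but not as a direct summand: there is no direct sum decomposition
`Q = D ⊕ C` such that the subquotient map carries `D` isomorphically onto `P`. -/
def NonsplitIn (P Q : Constituent R M) : Prop :=
  Q.lower ≤ P.lower ∧ P.upper ≤ Q.upper ∧
    ¬ ∃ D C : Submodule R M, D ⊔ C = Q.upper ∧ D ⊓ C = Q.lower ∧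
      P.lower ⊔ D = P.upper ∧ P.lower ⊓ D = Q.lower

/-- The ordering `P ⋖ Q` ("`Q` encloses `P`") on virtual constituents: the reflexive and transitive
relation, compatible with equality in the virtual category, generated by being a non-split
(submodule of a) subquotient. -/
def Enclosed : Constituent R M → Constituent R M → Prop :=
  Relation.ReflTransGen fun P Q => VirtEq P Q ∨ NonsplitIn P Q

/-- The part of `E = L / N` on the `(i+1)`-st radical layer `rad^i M / rad^(i+1) M` of `M`, that is
`(N + L ∩ rad^i M) / (N + L ∩ rad^(i+1) M)`, is nonzero. -/
def MeetsRadLayer (E : Constituent R M) (i : ℕ) : Prop :=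
  E.lower ⊔ (E.upper ⊓ radPow R M (i + 1)) ≠ E.lower ⊔ (E.upper ⊓ radPow R M i)

/-- The part of `E = L / N` on the `(i+1)`-st socle layer `S_(i+1)(M) / S_i(M)` of `M`, that is
`(N + L ∩ S_(i+1)(M)) / (N + L ∩ S_i(M))`, is nonzero. -/
def MeetsSocLayer (E : Constituent R M) (i : ℕ) : Prop :=
  E.lower ⊔ (E.upper ⊓ socPow R M (i + 1)) ≠ E.lower ⊔ (E.upper ⊓ socPow R M i)

/-- The lowest simple constituents of `E` in the radical series of `M` lie on the `d`-th layer
`rad^(d-1) M / rad^d M`. -/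
def RadDepth (E : Constituent R M) (d : ℕ) : Prop :=
  IsGreatest {k : ℕ | ∃ i : ℕ, k = i + 1 ∧ E.MeetsRadLayer i} d

/-- The highest simple constituents of `E` in the socle series of `M` lie on the `d`-th layer
`S_d(M) / S_(d-1)(M)`. -/
def SocDepth (E : Constituent R M) (d : ℕ) : Prop :=
  IsGreatest {k : ℕ | ∃ i : ℕ, k = i + 1 ∧ E.MeetsSocLayer i} d

/-- `M / X` is a maximal-depth `E`-enclosing quotient of `M`: it encloses `E`, and its Loewy length
is the number of the lowest radical layer of `M` on which `E` has constituents. -/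
def MaxDepthEnclosingQuotient (E : Constituent R M) (X : Submodule R M) : Prop :=
  Enclosed E (quot X) ∧ ∃ d : ℕ, E.RadDepth d ∧ HasLoewyLength R (M ⧸ X) d

/-- `Y` is a maximal-depth `E`-enclosing submodule of `M`: it encloses `E`, and its Loewy length is
the number of the highest socle layer of `M` on which `E` has constituents. -/
def MaxDepthEnclosingSubmodule (E : Constituent R M) (Y : Submodule R M) : Prop :=
  Enclosed E (sub Y) ∧ ∃ d : ℕ, E.SocDepth d ∧ HasLoewyLength R ↥Y d

end Constituent

open Constituent

variable {R : Type u} [Ring R] {M : Type v} [AddCommGroup M] [Module R M]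

/-- For `N ≤ K ≤ L`: `M / X` is a maximal-depth `E`-enclosing quotient of `M`, for `E = L / N`, that
has `E` as the submodule `(L + X) / X ≙ L / (L ∩ X) = L / N`, and there is an injective hull
`j : B → I` of `B = K / N` over `M / X`: `M / X` embeds in `I` by a map that restricts to `j`
on `B`. So `E ⊆ M / X ⊆ I`. -/
def IsHullQuotient (N K L : Submodule R M) (hNL : N ≤ L) (X : Submodule R M) : Prop :=
  MaxDepthEnclosingQuotient (Constituent.of N L hNL) X ∧
  L ⊓ X = N ∧
  ∃ (I : Type (max u v)) (_ : AddCommGroup I) (_ : Module R I)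
    (j : (↥K ⧸ N.submoduleOf K) →ₗ[R] I) (f : (M ⧸ X) →ₗ[R] I),
    IsInjectiveHull j ∧ Function.Injective f ∧
      ∀ k : ↥K, f (X.mkQ (k : M)) = j ((N.submoduleOf K).mkQ k)

/-- For `N ≤ K ≤ L`: `Y` is a maximal-depth `E`-enclosing submodule of `M`, for `E = L / N`, that
has `E` as the quotient `Y / (Y ∩ N) ≙ (Y + N) / N = L / N`, and there is a projective cover
`p : P → A` of `A = L / K` over `Y`: `P` maps onto `Y` by a map that induces `p` on `A`.
So `P ↠ Y ↠ E`. -/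
def IsCoverSubmodule (N K L : Submodule R M) (hNL : N ≤ L) (Y : Submodule R M) : Prop :=
  MaxDepthEnclosingSubmodule (Constituent.of N L hNL) Y ∧
  Y ⊔ N = L ∧
  ∃ (P : Type (max u v)) (_ : AddCommGroup P) (_ : Module R P)
    (p : P →ₗ[R] (↥L ⧸ K.submoduleOf L)) (g : P →ₗ[R] ↥Y) (hYL : Y ≤ L),
    IsProjectiveCover p ∧ Function.Surjective g ∧
      ∀ x : P, (K.submoduleOf L).mkQ (Submodule.inclusion hYL (g x)) = p x

end VirtualExt

namespace VirtualExt

universe u v w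

open Submodule

/-! ### The radical series under surjections. -/

section Radical

variable {R : Type u} [Ring R] {M : Type v} [AddCommGroup M] [Module R M]
  {M' : Type w} [AddCommGroup M'] [Module R M']

/-! Being indecomposable of length two, E is uniserial: B is essential and superfluous in E
(`uniserial_of_length_two`).

For (1), let d be the radical depth of E. Then N + rad^d M meets K in N, and X is taken maximal
among the submodules that contain it and still meet K in N. Maximality makes B essential in M/X, so
a hull of B can be built around M/X. Essentiality of B in E gives L ∩ X = N. The Loewy length is d
because radical powers pass to quotients: X contains rad^d M but not rad^(d-1) M.

For (2), dually, let d be the socle depth and take Y minimal in L ∩ S_d(M) with Y + K = L. By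
minimality a lift P_A → Y of the cover of A is onto, and superfluity of B in E gives Y + N = L. The
Loewy length is d because a submodule has radical length at most d exactly when it lies in S_d(M).

Enclosure of E follows from indecomposability of M/X, respectively minimality of Y.
Indecomposability holds since every nonzero submodule of I_B contains B, and every submodule of Y
not killed in A is all of Y. Maximal elements exist because an enclosure that is not a virtual
equality strictly increases composition length. -/

theorem isSemisimpleModule_quotient_jacobson [IsArtinian R M] :
    IsSemisimpleModule R (M ⧸ Module.jacobson R M) :=
  (IsArtinian.isSemisimpleModule_iff_jacobson R _).2 (Module.jacobson_quotient_jacobson R M)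

/-- Over an Artinian module, the radical is compatible with surjections. -/
theorem map_jacobson_of_surjective [IsArtinian R M] (f : M →ₗ[R] M')
    (hf : Function.Surjective f) : (Module.jacobson R M).map f = Module.jacobson R M' := by
  refine le_antisymm (Module.map_jacobson_le f) (Module.jacobson_le_of_eq_bot ?_)
  have := isSemisimpleModule_quotient_jacobson (R := R) (M := M)
  -- M'/f(rad M) is a quotient of the semisimple module M/rad M, so its radical vanishes.
  have hs : Function.Surjective (mapQ (Module.jacobson R M) ((Module.jacobson R M).map f) f
      (le_comap_map f _)) := by
    intro y
    obtain ⟨y, rfl⟩ := mkQ_surjective _ y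
    obtain ⟨x, rfl⟩ := hf y
    exact ⟨mkQ _ x, rfl⟩
  have := IsSemisimpleModule.of_surjective _ hs
  exact IsSemisimpleModule.jacobson_eq_bot R _

theorem map_radPow_of_surjective [IsArtinian R M] (f : M →ₗ[R] M')
    (hf : Function.Surjective f) (i : ℕ) : (radPow R M i).map f = radPow R M' i := by
  induction i with
  | zero => simpa [radPow] using LinearMap.range_eq_top.2 hf
  | succ i ih =>
    have hmem : ∀ x ∈ radPow R M i, f x ∈ radPow R M' i := fun x hx => ih ▸ mem_map_of_mem hx
    have hs : Function.Surjective (f.restrict hmem) := by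
      rintro ⟨y, hy⟩
      rw [← ih] at hy
      obtain ⟨x, hx, rfl⟩ := hy
      exact ⟨⟨x, hx⟩, rfl⟩
    rw [radPow, radPow, ← map_jacobson_of_surjective _ hs, ← map_comp, ← map_comp]
    rfl

theorem radPow_succ_le (i : ℕ) : radPow R M (i + 1) ≤ radPow R M i :=
  map_subtype_le _ _

theorem radPow_antitone : Antitone (radPow R M) := antitone_nat_of_succ_le radPow_succ_le

theorem map_jacobson_subtype_lt [IsNoetherian R M] {W : Submodule R M} (hW : W ≠ ⊥) :
    (Module.jacobson R W).map W.subtype < W := by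
  have := (nontrivial_iff_ne_bot).2 hW
  have h := Module.jacobson_lt_top R W
  refine lt_of_le_of_ne (map_subtype_le _ _) fun he => h.ne ?_
  apply map_injective_of_injective W.injective_subtype
  simpa using he

theorem exists_radPow_eq_bot [IsArtinian R M] [IsNoetherian R M] : ∃ n, radPow R M n = ⊥ := by
  obtain ⟨n, hn⟩ := IsArtinian.monotone_stabilizes (R := R) (M := M)
    ⟨fun i => OrderDual.toDual (radPow R M i), fun i j h => radPow_antitone h⟩
  refine ⟨n, ?_⟩
  by_contra h
  exact (map_jacobson_subtype_lt h).ne (hn (n + 1) n.le_succ).symm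

end Radical

/-! ### The socle series, and its comparison with Loewy length. -/

section Socle

variable {R : Type u} [Ring R] {M : Type v} [AddCommGroup M] [Module R M]
  {Z : Type w} [AddCommGroup Z] [Module R Z]

theorem isSemisimpleModule_socle : IsSemisimpleModule R (socle R M) := by
  rw [socle, sSup_eq_iSup]
  exact isSemisimpleModule_biSup_of_isSemisimpleModule_submodule fun S hS => by
    have : IsSimpleModule R S := hS
    infer_instance

theorem le_socle (W : Submodule R M) [IsSemisimpleModule R W] : W ≤ socle R M := by
  have h : (⊤ : Submodule R W) ≤ (socle R M).comap W.subtype := by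
    rw [← IsSemisimpleModule.sSup_simples_eq_top R W]
    refine sSup_le fun S hS => map_le_iff_le_comap.1 (le_sSup ?_)
    have : IsSimpleModule R S := hS
    exact IsSimpleModule.congr (S.equivMapOfInjective W.subtype W.injective_subtype).symm
  exact fun x hx => h (mem_top : (⟨x, hx⟩ : W) ∈ ⊤)

theorem socle_ne_bot [IsArtinian R M] [Nontrivial M] : socle R M ≠ ⊥ := by
  obtain ⟨S, hS, -⟩ := (eq_bot_or_exists_atom_le (⊤ : Submodule R M)).resolve_left top_ne_bot
  exact fun h => hS.1 (le_bot_iff.1 (h ▸ le_sSup (isSimpleModule_iff_isAtom.2 hS)))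

theorem socPow_le_succ (i : ℕ) : socPow R M i ≤ socPow R M (i + 1) := by
  rw [socPow]
  exact le_comap_mkQ _ _

theorem socPow_monotone : Monotone (socPow R M) := monotone_nat_of_le_succ socPow_le_succ

theorem exists_socPow_eq_top [IsArtinian R M] [IsNoetherian R M] : ∃ n, socPow R M n = ⊤ := by
  obtain ⟨n, hn⟩ := monotone_stabilizes_iff_noetherian.2 (inferInstance : IsNoetherian R M)
    ⟨socPow R M, socPow_monotone⟩
  refine ⟨n, ?_⟩
  by_contra h
  have : Nontrivial (M ⧸ socPow R M n) := Quotient.nontrivial_iff.2 h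
  apply socle_ne_bot (R := R) (M := M ⧸ socPow R M n)
  have h1 : socPow R M n = socPow R M (n + 1) := hn (n + 1) n.le_succ
  rw [← map_comap_eq_of_surjective (mkQ_surjective (socPow R M n)) (socle R _)]
  change map _ (socPow R M (n + 1)) = ⊥
  rw [← h1, mkQ_map_self]

/-- The induced map from W to M/S_k has image in a semisimple module, so it kills rad W. One step
down the radical series thus costs at least one socle layer. -/
theorem map_jacobson_le_socPow (f : Z →ₗ[R] M) {W : Submodule R Z} {k : ℕ}
    (h : W.map f ≤ socPow R M (k + 1)) :
    ((Module.jacobson R W).map W.subtype).map f ≤ socPow R M k := by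
  let g : W →ₗ[R] socle R (M ⧸ socPow R M k) :=
    ((socPow R M k).mkQ ∘ₗ f ∘ₗ W.subtype).codRestrict _
      fun x => h (mem_map_of_mem x.2)
  have := isSemisimpleModule_socle (R := R) (M := M ⧸ socPow R M k)
  have hg := Module.le_comap_jacobson g
  rw [IsSemisimpleModule.jacobson_eq_bot R (socle R (M ⧸ socPow R M k))] at hg
  rintro _ ⟨_, ⟨x, hx, rfl⟩, rfl⟩
  have h0 : g x = 0 := by simpa using hg hx
  exact (Submodule.Quotient.mk_eq_zero _).1 (congrArg Subtype.val h0)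

/-- The map to M/S_k factors through W/rad W, which is semisimple as W is Artinian; its image
therefore lies in the socle. -/
theorem map_le_socPow_succ (f : Z →ₗ[R] M) [IsArtinian R Z] {W : Submodule R Z} {k : ℕ}
    (h : ((Module.jacobson R W).map W.subtype).map f ≤ socPow R M k) :
    W.map f ≤ socPow R M (k + 1) := by
  let g : (W ⧸ Module.jacobson R W) →ₗ[R] M ⧸ socPow R M k :=
    (Module.jacobson R W).liftQ ((socPow R M k).mkQ ∘ₗ f ∘ₗ W.subtype) fun x hx =>
      (Submodule.Quotient.mk_eq_zero _).2 (h ⟨x, ⟨x, hx, rfl⟩, rfl⟩)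
  have := isSemisimpleModule_quotient_jacobson (R := R) (M := W)
  have := IsSemisimpleModule.range g
  rintro _ ⟨x, hx, rfl⟩
  exact le_socle (LinearMap.range g) ⟨mkQ _ ⟨x, hx⟩, rfl⟩

theorem map_radPow_le_socPow (f : Z →ₗ[R] M) {d : ℕ} (h : LinearMap.range f ≤ socPow R M d)
    (i j : ℕ) (hij : i + j = d) : (radPow R Z i).map f ≤ socPow R M j := by
  induction i generalizing j with
  | zero =>
    obtain rfl : j = d := by omega
    simpa [radPow] using h
  | succ i ih => exact map_jacobson_le_socPow f (ih (j + 1) (by omega))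

theorem radPow_eq_bot_of_range_le_socPow (f : Z →ₗ[R] M) (hf : Function.Injective f) {d : ℕ}
    (h : LinearMap.range f ≤ socPow R M d) : radPow R Z d = ⊥ := by
  have := map_radPow_le_socPow f h d 0 (by omega)
  exact map_injective_of_injective hf ((le_bot_iff.1 this).trans (map_bot f).symm)

theorem range_le_socPow_of_radPow_eq_bot (f : Z →ₗ[R] M) [IsArtinian R Z] {d : ℕ}
    (h : radPow R Z d = ⊥) : LinearMap.range f ≤ socPow R M d := by
  have key : ∀ j i, i + j = d → (radPow R Z i).map f ≤ socPow R M j := by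
    intro j
    induction j with
    | zero =>
      intro i hi
      obtain rfl : i = d := by omega
      simp [h]
    | succ j ih => exact fun i hi => map_le_socPow_succ f (ih (i + 1) (by omega))
  simpa [radPow] using key d 0 (by omega)

end Socle

/-! ### Construction of injective hulls. -/

section InjectiveHull

variable {R : Type u} [Ring R]

/-- A submodule `T` can be enlarged to a maximal one having the same intersection with `H`. -/
theorem exists_maximal_inf_eq {M : Type v} [AddCommGroup M] [Module R M] (T H N : Submodule R M)
    (hT : T ⊓ H = N) : ∃ C, T ≤ C ∧ Maximal (fun C => C ⊓ H = N) C := by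
  refine zorn_le_nonempty₀ {C | C ⊓ H = N} (fun c hc hchain y hy => ?_) T hT
  refine ⟨sSup c, le_antisymm ?_ ?_, fun z hz => le_sSup hz⟩
  · rintro x ⟨hx, hxH⟩
    obtain ⟨C, hC, hxC⟩ := (mem_sSup_of_directed ⟨y, hy⟩ hchain.directedOn).1 hx
    exact (hc hC).le ⟨hxC, hxH⟩
  · exact (hc hy).ge.trans (inf_le_inf_right _ (le_sSup hy))

/-- Inside an injective module, every submodule has an injective hull. -/
theorem exists_injective_essential_ge {J : Type w} [AddCommGroup J] [Module R J]
    [Module.Injective R J] (S : Submodule R J) :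
    ∃ H : Submodule R J, S ≤ H ∧ Module.Injective R H ∧ ∀ U ≤ H, U ⊓ S = ⊥ → U = ⊥ := by
  obtain ⟨H, hSH, hmax⟩ := zorn_le_nonempty₀
    {H : Submodule R J | S ≤ H ∧ ∀ U ≤ H, U ⊓ S = ⊥ → U = ⊥} (fun c hc hchain y hy => by
      refine ⟨sSup c, ⟨(hc hy).1.trans (le_sSup hy), fun U hU hUS => ?_⟩, fun z hz => le_sSup hz⟩
      rw [eq_bot_iff]
      intro x hx
      obtain ⟨C, hC, hxC⟩ := (mem_sSup_of_directed ⟨y, hy⟩ hchain.directedOn).1 (hU hx)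
      have h1 : span R {x} ≤ U := by simpa using hx
      have h2 : span R {x} = ⊥ := (hc hC).2 _ (by simpa using hxC)
        (le_bot_iff.1 ((inf_le_inf_right _ h1).trans hUS.le))
      simpa using h2) S ⟨le_rfl, fun U hU hUS => by rwa [inf_eq_left.2 hU] at hUS⟩
  obtain ⟨-, hess⟩ := hmax.prop
  refine ⟨H, hSH, ?_, hess⟩
  -- With C maximal subject to C ∩ H = 0, the image of H in J/C is essential. The inclusion of H
  -- then extends to an injective map h from J/C to J, whose image is again essential over S.
  -- Maximality of H makes that image H itself, so H is a retract of J.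
  obtain ⟨C, -, hC⟩ := exists_maximal_inf_eq (⊥ : Submodule R J) H ⊥ (by simp)
  have hφ : Function.Injective (C.mkQ ∘ₗ H.subtype) := by
    rw [← LinearMap.ker_eq_bot, eq_bot_iff]
    intro x hx
    have : (x : J) ∈ C ⊓ H := ⟨by simpa using hx, x.2⟩
    simpa [hC.prop] using this
  have hφess : ∀ V : Submodule R (J ⧸ C), V ⊓ H.map C.mkQ = ⊥ → V = ⊥ := by
    intro V hV
    have h1 : V.comap C.mkQ ⊓ H = ⊥ := by
      rw [eq_bot_iff, ← hC.prop]
      rintro x ⟨hxV, hxH⟩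
      have : C.mkQ x ∈ V ⊓ H.map C.mkQ := ⟨hxV, mem_map_of_mem hxH⟩
      rw [hV] at this
      exact ⟨by simpa using this, hxH⟩
    have h2 := hC.eq_of_ge h1 (le_comap_mkQ C V)
    rw [← map_comap_eq_of_surjective (mkQ_surjective C) V, h2, mkQ_map_self]
  obtain ⟨h, hh⟩ := Module.Injective.out (C.mkQ ∘ₗ H.subtype) hφ H.subtype
  replace hh : ∀ x ∈ H, h (C.mkQ x) = x := fun x hx => hh ⟨x, hx⟩
  have hinj : Function.Injective h := by
    rw [← LinearMap.ker_eq_bot]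
    refine hφess _ ?_
    rw [eq_bot_iff]
    rintro _ ⟨hk, x, hx, rfl⟩
    have := hh x hx
    rw [LinearMap.mem_ker.1 hk] at this
    simp [← this]
  have hle : H ≤ LinearMap.range h := fun x hx => ⟨C.mkQ x, hh x hx⟩
  have hrange : LinearMap.range h = H := by
    refine hmax.eq_of_ge ⟨hSH.trans hle, fun U hU hUS => ?_⟩ hle
    have h1 : U ⊓ H = ⊥ := hess _ inf_le_right
      (le_bot_iff.1 ((inf_le_inf_right _ inf_le_left).trans hUS.le))
    have h2 : U.comap h = ⊥ := by
      refine hφess _ ?_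
      rw [eq_bot_iff]
      rintro _ ⟨hk, x, hx, rfl⟩
      have hk' : h (C.mkQ x) ∈ U := hk
      rw [hh x hx] at hk'
      have : x ∈ U ⊓ H := ⟨hk', hx⟩
      rw [h1] at this
      simp [(mem_bot R).1 this]
    rw [← inf_eq_right.2 hU, ← map_comap_eq, h2, Submodule.map_bot]
  refine ⟨fun X Y _ _ _ _ f hf g => ?_⟩
  obtain ⟨k, hk⟩ := Module.Injective.out f hf (H.subtype ∘ₗ g)
  refine ⟨(h ∘ₗ C.mkQ ∘ₗ k).codRestrict H fun y => hrange ▸ ⟨_, rfl⟩, fun x => Subtype.ext ?_⟩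
  change h (C.mkQ (k (f x))) = g x
  rw [hk]
  exact hh _ (g x).2

/-- Every module embeds in an injective module. -/
theorem exists_injective_embedding (M : Type v) [AddCommGroup M] [Module R M] :
    ∃ (J : Type (max u v)) (_ : AddCommGroup J) (_ : Module R J) (f : M →ₗ[R] J),
      Module.Injective R J ∧ Function.Injective f := by
  have := ModuleCat.enoughInjectives.{v} R
  let X : ModuleCat.{max u v} R := ModuleCat.of R (ULift.{u} M)
  let J := CategoryTheory.Injective.under X
  refine ⟨J, inferInstance, inferInstance,
    (CategoryTheory.Injective.ι X).hom ∘ₗ ULift.moduleEquiv.symm.toLinearMap, ?_, ?_⟩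
  · have : CategoryTheory.Injective (ModuleCat.of R J) :=
      inferInstanceAs (CategoryTheory.Injective J)
    exact Module.injective_module_of_injective_object R J
  · have h := (ModuleCat.mono_iff_injective (CategoryTheory.Injective.ι X)).1 inferInstance
    exact h.comp ULift.moduleEquiv.symm.injective

/-- An essential extension `i : B → M` extends to an injective hull of `B`. -/
theorem exists_isInjectiveHull_of_essential {M B : Type v} [AddCommGroup M] [Module R M]
    [AddCommGroup B] [Module R B] (i : B →ₗ[R] M) (hi : Function.Injective i)
    (hess : ∀ U : Submodule R M, U ⊓ LinearMap.range i = ⊥ → U = ⊥) :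
    ∃ (I : Type (max u v)) (_ : AddCommGroup I) (_ : Module R I) (f : M →ₗ[R] I),
      Function.Injective f ∧ IsInjectiveHull (f ∘ₗ i) := by
  obtain ⟨J, _, _, f, hJ, hf⟩ := exists_injective_embedding (R := R) M
  obtain ⟨H, hfH, hH, hHess⟩ := exists_injective_essential_ge (LinearMap.range f)
  let f' : M →ₗ[R] H := f.codRestrict H fun x => hfH ⟨x, rfl⟩
  have hf' : Function.Injective f' := fun x y h => hf (congrArg Subtype.val h)
  refine ⟨H, inferInstance, inferInstance, f', hf', hH, hf'.comp hi, fun U hU => ?_⟩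
  -- Essentiality is transitive: B is essential in M, and M in H.
  have h1 : U.comap f' = ⊥ := by
    refine hess _ ?_
    rw [eq_bot_iff]
    rintro _ ⟨hxU, b, rfl⟩
    have h2 : f' (i b) ∈ U ⊓ LinearMap.range (f' ∘ₗ i) := ⟨hxU, b, rfl⟩
    rw [hU] at h2
    simpa using hf' (((mem_bot R).1 h2).trans (map_zero f').symm)
  have h3 : U.map H.subtype = ⊥ := by
    refine hHess _ (map_subtype_le _ _) ?_
    rw [eq_bot_iff]
    rintro _ ⟨⟨y, hy, rfl⟩, x, hx⟩
    have h4 : f' x = y := Subtype.ext hx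
    have h5 : x ∈ U.comap f' := by rw [mem_comap, h4]; exact hy
    rw [h1, mem_bot] at h5
    rw [← h4, h5]
    simp
  exact map_injective_of_injective H.injective_subtype (h3.trans (Submodule.map_bot _).symm)

end InjectiveHull

/-! ### Projective covers of simple modules over Artinian rings. -/

section ProjectiveCover

variable {R : Type u} [Ring R]

/-- Over a left Artinian ring, every simple module has a projective cover. -/
theorem hasProjectiveCover_of_isArtinianRing [IsArtinianRing R] (A : Type v) [AddCommGroup A]
    [Module R A] [IsSimpleModule R A] : HasProjectiveCover R A := by
  have := IsSimpleModule.nontrivial R A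
  obtain ⟨a, ha⟩ := exists_ne (0 : A)
  let f : R →ₗ[R] A := LinearMap.toSpanSingleton R A a
  have hf : Function.Surjective f := IsSimpleModule.toSpanSingleton_surjective R ha
  obtain ⟨U, hU, hmin⟩ := IsArtinian.set_has_minimal {U : Submodule R R | U.map f = ⊤}
    ⟨⊤, by simpa using LinearMap.range_eq_top.2 hf⟩
  replace hmin : ∀ V ≤ U, V.map f = ⊤ → V = U := fun V hV hVf =>
    hV.eq_of_not_lt (hmin V hVf)
  have hUs : Function.Surjective (f ∘ₗ U.subtype) := by
    rw [← LinearMap.range_eq_top, LinearMap.range_comp, range_subtype]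
    exact hU
  -- The restriction of g to U is an endomorphism over A. Its image still maps onto A, so it is onto
  -- by minimality of U, hence bijective by Noetherianity, and U is a direct summand of R.
  obtain ⟨g, hg⟩ := Module.projective_lifting_property (f ∘ₗ U.subtype) f hUs
  let e : U →ₗ[R] U := g ∘ₗ U.subtype
  have hes : Function.Surjective e := by
    have h1 : (LinearMap.range e).map U.subtype = U := by
      refine hmin _ (map_subtype_le _ _) ?_
      rw [← map_comp, ← LinearMap.range_comp, ← LinearMap.comp_assoc, hg]
      exact LinearMap.range_eq_top.2 hUs
    rw [← LinearMap.range_eq_top]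
    apply map_injective_of_injective U.injective_subtype
    simpa using h1
  have hei := IsNoetherian.injective_of_surjective_endomorphism e hes
  let e' := LinearEquiv.ofBijective e ⟨hei, hes⟩
  have hproj : Module.Projective R U :=
    Module.Projective.of_split U.subtype (e'.symm.toLinearMap ∘ₗ g) <|
      LinearMap.ext fun x => e'.symm_apply_apply x
  let q : ULift.{v} U ≃ₗ[R] U := ULift.moduleEquiv
  refine ⟨ULift.{v} U, inferInstance, inferInstance,
    f ∘ₗ U.subtype ∘ₗ q.toLinearMap,
    Module.Projective.of_equiv q.symm,
    hUs.comp q.surjective, fun V hV => ?_⟩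
  -- Minimality of U also makes the kernel superfluous: V plus the kernel being everything means
  -- that V maps onto A.
  have h1 : (V.map q.toLinearMap).map U.subtype = U := by
    refine hmin _ (map_subtype_le _ _) ?_
    rw [← map_comp, ← map_comp, eq_top_iff]
    intro y _
    obtain ⟨x, rfl⟩ := (hUs.comp q.surjective) y
    obtain ⟨s, hs, t, ht, rfl⟩ := mem_sup.1 (hV ▸ mem_top : x ∈ V ⊔ _)
    refine ⟨s, hs, ?_⟩
    have h0 : f (q t) = 0 := ht
    simp [h0]
  rw [eq_top_iff]
  intro x _
  have hx : (q x : R) ∈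
    (V.map q.toLinearMap).map U.subtype := by
    rw [h1]
    exact (q x).2
  obtain ⟨_, ⟨y, hy, rfl⟩, hyx⟩ := hx
  rwa [← q.injective (Subtype.ext hyx)]

end ProjectiveCover

variable {R : Type u} [Ring R] {M : Type v} [AddCommGroup M] [Module R M]

/-! ### Composition length and the enclosure ordering. -/

namespace Constituent

/-- The composition length of the subquotient `upper / lower`. -/
noncomputable def length (P : Constituent R M) : ℕ∞ :=
  Module.length R (P.upper ⧸ P.lower.submoduleOf P.upper)

theorem length_lower_add_length (P : Constituent R M) :
    Module.length R P.lower + P.length = Module.length R P.upper := by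
  refine (Module.length_eq_add_of_exact (inclusion P.le) (P.lower.submoduleOf P.upper).mkQ
    (inclusion_injective _) (mkQ_surjective _) ?_).symm
  rw [LinearMap.exact_iff, ker_mkQ, range_inclusion]
  rfl

theorem VirtEq.length_eq {P Q : Constituent R M} (h : VirtEq P Q) : P.length = Q.length := by
  induction h with
  | rel P Q h =>
    obtain ⟨A, B, rfl, rfl⟩ := h
    have e := (LinearMap.quotientInfEquivSupQuotient A B).length_eq
    rw [← comap_inf] at e
    exact e.symm
  | refl => rfl
  | symm _ _ _ ih => exact ih.symm
  | trans _ _ _ _ _ ih₁ ih₂ => exact ih₁.trans ih₂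

variable [IsArtinian R M] [IsNoetherian R M]

theorem length_submodule_strictMono :
    StrictMono fun W : Submodule R M => Module.length R W := by
  intro W W' h
  simpa only [Module.length_submodule] using Submodule.height_strictMono h

theorem NonsplitIn.length_lt {P Q : Constituent R M} (h : NonsplitIn P Q) :
    P.length < Q.length := by
  obtain ⟨hl, hu, hns⟩ := h
  have hP := P.length_lower_add_length
  have hQ := Q.length_lower_add_length
  have hmono := (length_submodule_strictMono (R := R) (M := M))
  have hfin : ∀ W : Submodule R M, Module.length R W ≠ ⊤ := fun W => Module.length_ne_top
  have key : Module.length R Q.lower < Module.length R P.lower ∨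
      Module.length R P.upper < Module.length R Q.upper := by
    rcases hl.lt_or_eq with h | h
    · exact .inl (hmono h)
    rcases hu.lt_or_eq with h' | h'
    · exact .inr (hmono h')
    -- If both bounds agree, the trivial decomposition Q = Q ⊕ 0 exhibits P as a summand.
    refine absurd ⟨Q.upper, Q.lower, sup_eq_left.2 Q.le, inf_eq_right.2 Q.le, ?_, ?_⟩ hns
    · rw [← h, h', sup_eq_right.2 Q.le]
    · rw [← h, inf_eq_left.2 Q.le]
  have h1 := hmono.monotone hl
  have h2 := hmono.monotone hu
  have hPt : P.length ≠ ⊤ := fun h => hfin P.upper (by rw [← hP, h, add_top])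
  have hQt : Q.length ≠ ⊤ := fun h => hfin Q.upper (by rw [← hQ, h, add_top])
  generalize P.length = p at *
  generalize Q.length = q at *
  have a1 := hfin P.lower
  have a2 := hfin P.upper
  have a3 := hfin Q.lower
  have a4 := hfin Q.upper
  generalize Module.length R P.lower = pl at *
  generalize Module.length R P.upper = pu at *
  generalize Module.length R Q.lower = ql at *
  generalize Module.length R Q.upper = qu at *
  lift p to ℕ using hPt
  lift q to ℕ using hQt
  lift pl to ℕ using a1
  lift pu to ℕ using a2
  lift ql to ℕ using a3
  lift qu to ℕ using a4
  norm_cast at *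
  omega

/-- An enclosed constituent is shorter than the enclosing one, or virtually equal to it. -/
theorem Enclosed.virtEq_or_length_lt {P Q : Constituent R M} (h : Enclosed P Q) :
    VirtEq P Q ∨ P.length < Q.length := by
  induction h with
  | refl => exact .inl (.refl _)
  | tail _ hstep ih =>
    rcases ih with ih | ih <;> rcases hstep with h | h
    · exact .inl (.trans _ _ _ ih h)
    · exact .inr (ih.length_eq ▸ h.length_lt)
    · exact .inr (VirtEq.length_eq h ▸ ih)
    · exact .inr (ih.trans h.length_lt)

theorem Enclosed.virtEq_of_length_le {P Q : Constituent R M} (h : Enclosed P Q)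
    (hl : Q.length ≤ P.length) : VirtEq P Q :=
  h.virtEq_or_length_lt.resolve_right hl.not_gt

/-- A non-empty set of constituents has an `Enclosed`-maximal element. -/
theorem exists_enclosed_maximal {ι : Type*} (p : ι → Prop) (c : ι → Constituent R M)
    (hp : ∃ i, p i) :
    ∃ i, p i ∧ ∀ j, p j → Enclosed (c i) (c j) → VirtEq (c i) (c j) := by
  have hle : ∀ P : Constituent R M, P.length ≤ Module.length R M := fun P => by
    calc P.length ≤ Module.length R P.lower + P.length := le_add_self
      _ = Module.length R P.upper := P.length_lower_add_length
      _ ≤ Module.length R M := Module.length_le_of_injective _ P.upper.injective_subtype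
  -- Lengths are bounded by that of M; minimal colength means maximal length.
  obtain ⟨i, hi, hmin⟩ := exists_minimalFor_of_wellFoundedLT p
    (fun i => Module.length R M - (c i).length) hp
  refine ⟨i, hi, fun j hj h => h.virtEq_of_length_le ?_⟩
  have hfin : Module.length R M ≠ ⊤ := Module.length_ne_top
  have h1 := hle (c i)
  have h2 := hle (c j)
  by_contra! hlt
  have h3 := hmin hj
  dsimp only at h3
  generalize (c i).length = a at *
  generalize (c j).length = b at *
  generalize Module.length R M = m at *
  lift a to ℕ using ne_top_of_le_ne_top hfin h1
  lift b to ℕ using ne_top_of_le_ne_top hfin h2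
  lift m to ℕ using hfin
  norm_cast at *
  omega

end Constituent

/-! ### Depth, Loewy length and indecomposable subquotients. -/

open Constituent

/-- The last jump of an eventually constant sequence occurs just before the first index from which
it is constant. Both depths are instances: N + L ∩ rad^i M descends from L to N, and N + L ∩ S_i(M)
ascends from N to L. -/
theorem exists_isGreatest_jump {α : Type*} (F : ℕ → α) (b : α) (h0 : F 0 ≠ b)
    (hb : ∃ n, ∀ m ≥ n, F m = b) :
    ∃ i, IsGreatest {k : ℕ | ∃ i : ℕ, k = i + 1 ∧ F (i + 1) ≠ F i} (i + 1) ∧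
      F (i + 1) = b ∧ F i ≠ b := by
  classical
  obtain ⟨i, hi⟩ : ∃ i, Nat.find hb = i + 1 :=
    Nat.exists_eq_succ_of_ne_zero fun h => h0 (Nat.find_spec hb 0 (by omega))
  have hs := Nat.find_spec hb
  rw [hi] at hs
  have hne : F i ≠ b := fun h => Nat.find_min hb (m := i) (by omega) fun m hm => by
    rcases hm.eq_or_lt with rfl | hm
    · exact h
    · exact hs m hm
  have h1 := hs (i + 1) le_rfl
  refine ⟨i, ⟨⟨i, rfl, h1 ▸ hne.symm⟩, ?_⟩, h1, hne⟩
  rintro _ ⟨j, rfl, hj⟩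
  by_contra! hlt
  exact hj ((hs _ (by omega)).trans (hs _ (by omega)).symm)

theorem exists_radDepth [IsArtinian R M] [IsNoetherian R M] (E : Constituent R M)
    (hE : E.lower ≠ E.upper) :
    ∃ i, E.RadDepth (i + 1) ∧ E.lower ⊔ (E.upper ⊓ radPow R M (i + 1)) = E.lower ∧
      E.lower ⊔ (E.upper ⊓ radPow R M i) ≠ E.lower := by
  obtain ⟨n, hn⟩ := exists_radPow_eq_bot (R := R) (M := M)
  refine exists_isGreatest_jump (fun i => E.lower ⊔ (E.upper ⊓ radPow R M i)) E.lower ?_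
    ⟨n, fun m hm => ?_⟩
  · simpa [radPow, sup_eq_right.2 E.le] using hE.symm
  · simp [le_bot_iff.1 ((radPow_antitone hm).trans hn.le)]

theorem exists_socDepth [IsArtinian R M] [IsNoetherian R M] (E : Constituent R M)
    (hE : E.lower ≠ E.upper) :
    ∃ i, E.SocDepth (i + 1) ∧ E.lower ⊔ (E.upper ⊓ socPow R M (i + 1)) = E.upper ∧
      E.lower ⊔ (E.upper ⊓ socPow R M i) ≠ E.upper := by
  obtain ⟨n, hn⟩ := exists_socPow_eq_top (R := R) (M := M)
  refine exists_isGreatest_jump (fun i => E.lower ⊔ (E.upper ⊓ socPow R M i)) E.upper ?_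
    ⟨n, fun m hm => ?_⟩
  · simpa [socPow] using hE
  · simp [top_le_iff.1 (hn.ge.trans (socPow_monotone hm)), sup_eq_right.2 E.le]

theorem hasLoewyLength_succ {n : ℕ} (h : radPow R M (n + 1) = ⊥) (h' : radPow R M n ≠ ⊥) :
    HasLoewyLength R M (n + 1) := by
  refine ⟨h, fun m hm => ?_⟩
  by_contra! hlt
  exact h' (le_bot_iff.1 ((radPow_antitone (by omega : m ≤ n)).trans (le_of_eq hm)))

theorem Indecomposable.eq_or_eq_of_quotient {X D C : Submodule R M}
    (h : Indecomposable R (M ⧸ X)) (hsup : D ⊔ C = ⊤) (hinf : D ⊓ C = X) : D = X ∨ C = X := by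
  have hD : X ≤ D := hinf ▸ inf_le_left
  have hC : X ≤ C := hinf ▸ inf_le_right
  have hcomap : ∀ {W : Submodule R M}, X ≤ W → (W.map X.mkQ).comap X.mkQ = W := fun hW => by
    rw [comap_map_eq, ker_mkQ, sup_eq_left.2 hW]
  have hbot : ∀ {W : Submodule R M}, X ≤ W → W.map X.mkQ = ⊥ → W = X := fun hW h => by
    rw [← hcomap hW, h, comap_bot, ker_mkQ]
  refine (h.2 (D.map X.mkQ) (C.map X.mkQ) ⟨?_, ?_⟩).imp (hbot hD) (hbot hC)
  · rw [disjoint_iff]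
    apply comap_injective_of_surjective (mkQ_surjective X)
    rw [comap_inf, hcomap hD, hcomap hC, comap_bot, ker_mkQ, hinf]
  · rw [codisjoint_iff, ← Submodule.map_sup, hsup, Submodule.map_top, range_mkQ]

theorem Indecomposable.eq_or_eq_of_subquotient {N L D C : Submodule R M} (hNL : N ≤ L)
    (h : Indecomposable R (L ⧸ N.submoduleOf L)) (hsup : D ⊔ C = L) (hinf : D ⊓ C = N) :
    D = N ∨ C = N := by
  have hD : D ≤ L := hsup ▸ le_sup_left
  have hC : C ≤ L := hsup ▸ le_sup_right
  have hmap : ∀ {W : Submodule R M}, W ≤ L → (W.submoduleOf L).map L.subtype = W := fun hW => by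
    rw [submoduleOf, map_comap_subtype]
    exact inf_eq_right.2 hW
  have key := h.eq_or_eq_of_quotient (D := D.submoduleOf L) (C := C.submoduleOf L) ?_ ?_
  · refine key.imp (fun h => ?_) (fun h => ?_)
    · rw [← hmap hD, h, hmap hNL]
    · rw [← hmap hC, h, hmap hNL]
  · apply map_injective_of_injective L.injective_subtype
    rw [Submodule.map_sup, hmap hD, hmap hC, hsup, map_subtype_top]
  · rw [← hinf]
    rfl

/-- A module of length two that is indecomposable is uniserial. -/
theorem uniserial_of_length_two [IsArtinian R M] [IsNoetherian R M] {N K L : Submodule R M}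
    (hNK : N < K) (hKL : K < L) (hlen : Module.length R (L ⧸ N.submoduleOf L) = 2)
    (hind : Indecomposable R (L ⧸ N.submoduleOf L)) :
    N ⋖ K ∧ K ⋖ L ∧ (∀ Z, N ≤ Z → Z ≤ L → Z ⊓ K = N → Z = N) ∧
      (∀ Z, N ≤ Z → Z ≤ L → Z ⊔ K = L → Z = L) := by
  have hNL := (hNK.trans hKL).le
  -- Such a chain would force L/N to have length at least three.
  have hno : ∀ Z₁ Z₂, N < Z₁ → Z₁ < Z₂ → Z₂ < L → False := by
    intro Z₁ Z₂ h1 h2 h3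
    have hadd := (Constituent.of N L hNL).length_lower_add_length
    have hlen' : (Constituent.of N L hNL).length = 2 := hlen
    rw [hlen'] at hadd
    change Module.length R N + 2 = Module.length R L at hadd
    have hfin : ∀ W : Submodule R M, Module.length R W ≠ ⊤ := fun W => Module.length_ne_top
    have e1 := length_submodule_strictMono h1
    have e2 := length_submodule_strictMono h2
    have e3 := length_submodule_strictMono h3
    dsimp only at e1 e2 e3
    have a1 := hfin N
    have a2 := hfin Z₁
    have a3 := hfin Z₂
    have a4 := hfin L
    generalize Module.length R N = n at *
    generalize Module.length R Z₁ = z₁ at *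
    generalize Module.length R Z₂ = z₂ at *
    generalize Module.length R L = l at *
    lift n to ℕ using a1
    lift z₁ to ℕ using a2
    lift z₂ to ℕ using a3
    lift l to ℕ using a4
    norm_cast at *
    omega
  have hcN : N ⋖ K := ⟨hNK, fun Z h1 h2 => hno Z K h1 h2 hKL⟩
  have hcK : K ⋖ L := ⟨hKL, fun Z h1 h2 => hno K Z hNK h1 h2⟩
  refine ⟨hcN, hcK, fun Z hNZ hZL hZ => ?_, fun Z hNZ hZL hZ => ?_⟩
  · rcases hcK.eq_or_eq (c := Z ⊔ K) le_sup_right (sup_le hZL hKL.le) with h | h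
    · rw [← hZ, inf_eq_left.2 (sup_eq_right.1 h)]
    · exact (hind.eq_or_eq_of_subquotient hNL h hZ).resolve_right hNK.ne'
  · rcases hcN.eq_or_eq (c := Z ⊓ K) (le_inf hNZ hNK.le) inf_le_right with h | h
    · rcases hind.eq_or_eq_of_subquotient hNL hZ h with h' | h'
      · rw [h', sup_eq_right.2 hNK.le] at hZ
        exact absurd hZ hKL.ne
      · exact absurd h' hNK.ne'
    · rwa [sup_eq_left.2 (inf_eq_right.1 h)] at hZ

/-- A module between a simple module and its injective hull is indecomposable. -/
theorem indecomposable_of_isInjectiveHull {B : Type v} [AddCommGroup B] [Module R B]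
    [IsSimpleModule R B] {I : Type w} [AddCommGroup I] [Module R I] {j : B →ₗ[R] I}
    (hj : IsInjectiveHull j) {f : M →ₗ[R] I} (hf : Function.Injective f)
    (hjf : LinearMap.range j ≤ LinearMap.range f) : Indecomposable R M := by
  obtain ⟨-, hji, hess⟩ := hj
  have hatom : IsAtom (LinearMap.range j) :=
    isSimpleModule_iff_isAtom.1 (IsSimpleModule.congr (LinearEquiv.ofInjective j hji).symm)
  refine ⟨?_, fun P Q hPQ => ?_⟩
  · by_contra h
    rw [not_nontrivial_iff_subsingleton] at h
    exact hatom.1 (le_bot_iff.1 (hjf.trans (LinearMap.range_eq_bot.2 (Subsingleton.elim f 0)).le))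
  · by_contra! h
    -- The image of B is simple and essential, so every nonzero submodule of I contains it; two such
    -- submodules cannot meet in zero.
    have hge : ∀ W : Submodule R M, W ≠ ⊥ → LinearMap.range j ≤ W.map f := fun W hW => by
      by_contra hle
      refine hW (map_injective_of_injective hf ?_)
      rw [Submodule.map_bot]
      exact hess _ ((hatom.not_le_iff_disjoint.1 hle).symm.eq_bot)
    apply hatom.1
    rw [← le_bot_iff, ← Submodule.map_bot f, ← hPQ.inf_eq_bot, Submodule.map_inf f hf]
    exact le_inf (hge P h.1) (hge Q h.2)

/-- A module between a simple module and its projective cover is indecomposable. -/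
theorem indecomposable_of_isProjectiveCover {A : Type v} [AddCommGroup A] [Module R A]
    [IsSimpleModule R A] {P : Type w} [AddCommGroup P] [Module R P] {p : P →ₗ[R] A}
    (hp : IsProjectiveCover p) {g : P →ₗ[R] M} (hg : Function.Surjective g) {q : M →ₗ[R] A}
    (hq : q ∘ₗ g = p) : Indecomposable R M := by
  obtain ⟨-, hps, hsup⟩ := hp
  have hqs : Function.Surjective q := by
    rw [← hq] at hps
    exact Function.Surjective.of_comp hps
  have := IsSimpleModule.nontrivial R A
  refine ⟨hqs.nontrivial, fun D C hDC => ?_⟩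
  -- The kernel of q is maximal, so W together with it is everything; pulled back to P, superfluity
  -- of ker p applies.
  have htop : ∀ W : Submodule R M, ¬ W ≤ LinearMap.ker q → W = ⊤ := fun W hW => by
    have h1 : W ⊔ LinearMap.ker q = ⊤ :=
      (LinearMap.isCoatom_ker_of_surjective hqs).2 _ (right_lt_sup.2 hW)
    have h2 : W.comap g = ⊤ := hsup _ <| by
      rw [← hq, LinearMap.ker_comp, eq_top_iff]
      intro x _
      obtain ⟨s, hs, t, ht, hst⟩ := mem_sup.1 (h1 ▸ mem_top : g x ∈ W ⊔ LinearMap.ker q)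
      obtain ⟨y, rfl⟩ := hg s
      refine mem_sup.2 ⟨y, hs, x - y, ?_, by abel⟩
      simpa [← hst] using ht
    rw [← map_comap_eq_of_surjective hg W, h2, Submodule.map_top, LinearMap.range_eq_top.2 hg]
  by_cases hD : D ≤ LinearMap.ker q
  · by_cases hC : C ≤ LinearMap.ker q
    · have : LinearMap.ker q = ⊤ := top_le_iff.1 (hDC.sup_eq_top.ge.trans (sup_le hD hC))
      exact absurd this (LinearMap.isCoatom_ker_of_surjective hqs).1
    · left
      simpa [htop C hC] using hDC.inf_eq_bot
  · right
    simpa [htop D hD] using hDC.inf_eq_bot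

theorem isSimpleModule_subquotient {N K : Submodule R M} (h : N ⋖ K) :
    IsSimpleModule R (K ⧸ N.submoduleOf K) :=
  (covBy_iff_quot_is_simple h.le).1 h

theorem IsHullQuotient.indecomposable {N K L X : Submodule R M} {hNL : N ≤ L} (hNK : N ⋖ K)
    (h : IsHullQuotient N K L hNL X) : Indecomposable R (M ⧸ X) := by
  obtain ⟨-, -, I, _, _, j, f, hj, hf, hfj⟩ := h
  have := isSimpleModule_subquotient hNK
  refine indecomposable_of_isInjectiveHull hj hf ?_
  rintro _ ⟨b, rfl⟩
  obtain ⟨k, rfl⟩ := mkQ_surjective _ b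
  exact ⟨_, hfj k⟩

theorem IsCoverSubmodule.indecomposable {N K L Y : Submodule R M} {hNL : N ≤ L} (hKL : K ⋖ L)
    (h : IsCoverSubmodule N K L hNL Y) : Indecomposable R Y := by
  obtain ⟨-, -, P, _, _, p, g, hYL, hp, hg, hgp⟩ := h
  have := isSimpleModule_subquotient hKL
  exact indecomposable_of_isProjectiveCover hp hg
    (q := (K.submoduleOf L).mkQ ∘ₗ inclusion hYL) (LinearMap.ext hgp)

/-- An indecomposable quotient `M / X` that contains `E = L / N` as the submodule `(L + X) / X`
encloses `E`. -/
theorem enclosed_quot {N L X : Submodule R M} (hNL : N ≤ L) (hne : N ≠ L) (hLX : L ⊓ X = N)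
    (hind : Indecomposable R (M ⧸ X)) : Enclosed (Constituent.of N L hNL) (quot X) := by
  have hvirt : VirtEq (Constituent.of N L hNL) ⟨X, L ⊔ X, le_sup_right⟩ := by
    subst hLX
    exact .symm _ _ (.rel _ _ ⟨L, X, rfl, rfl⟩)
  refine (Relation.ReflTransGen.single (.inl hvirt)).trans ?_
  -- If L + X = M, then E is virtually M/X itself. Otherwise (L + X)/X is a nonzero proper
  -- submodule, which an indecomposable module cannot split off.
  by_cases htop : L ⊔ X = ⊤
  · have : (⟨X, L ⊔ X, le_sup_right⟩ : Constituent R M) = quot X := by simp [quot, htop]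
    rw [this]
  refine .single (.inr ⟨le_rfl, le_top, ?_⟩)
  rintro ⟨D, C, hsup, hinf, hD, -⟩
  change D ⊔ C = ⊤ at hsup
  change D ⊓ C = X at hinf
  change X ⊔ D = L ⊔ X at hD
  rw [sup_eq_right.2 (hinf ▸ inf_le_left)] at hD
  rcases hind.eq_or_eq_of_quotient hsup hinf with h | h
  · rw [h] at hD
    have hle : L ≤ X := sup_eq_right.1 hD.symm
    exact hne (by rw [← hLX, inf_eq_left.2 hle])
  · rw [h, sup_eq_left.2 (hinf ▸ inf_le_left)] at hsup
    exact htop (hD ▸ hsup)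

/-- A submodule `Y` minimal among those that map onto `E = L / N` encloses `E`. -/
theorem enclosed_sub {N L Y : Submodule R M} (hNL : N ≤ L) (hYL : Y ⊔ N = L)
    (hmin : ∀ D ≤ Y, D ⊔ N = L → D = Y) : Enclosed (Constituent.of N L hNL) (sub Y) := by
  have hvirt : VirtEq (Constituent.of N L hNL) ⟨Y ⊓ N, Y, inf_le_left⟩ := by
    subst hYL
    exact .rel _ _ ⟨Y, N, rfl, rfl⟩
  refine (Relation.ReflTransGen.single (.inl hvirt)).trans ?_
  by_cases hbot : Y ⊓ N = ⊥
  · have : (⟨Y ⊓ N, Y, inf_le_left⟩ : Constituent R M) = sub Y := by simp [sub, hbot]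
    rw [this]
  refine .single (.inr ⟨bot_le, le_rfl, ?_⟩)
  rintro ⟨D, C, hsup, -, hD, hD'⟩
  change D ⊔ C = Y at hsup
  change Y ⊓ N ⊔ D = Y at hD
  change Y ⊓ N ⊓ D = ⊥ at hD'
  have hDY : D ≤ Y := hsup ▸ le_sup_left
  -- A splitting D maps onto E, so D = Y by minimality, and then Y ∩ N = D ∩ (Y ∩ N) = 0.
  have hDN : D ⊔ N = L := by
    refine le_antisymm (hYL ▸ sup_le_sup_right hDY N) ?_
    rw [← hYL]
    refine sup_le ?_ le_sup_right
    rw [← hD]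
    exact sup_le (inf_le_right.trans le_sup_right) le_sup_left
  rw [hmin D hDY hDN, inf_eq_left.2 inf_le_left] at hD'
  exact hbot hD'

/-! ### Existence of the enclosing quotient and submodule. -/

variable [IsArtinian R M] [IsNoetherian R M]

theorem exists_isHullQuotient {N K L : Submodule R M} (hNK : N ⋖ K) (hKL : K < L)
    (hsoc : ∀ Z, N ≤ Z → Z ≤ L → Z ⊓ K = N → Z = N) :
    ∃ X, IsHullQuotient N K L (hNK.lt.trans hKL).le X := by
  have hNL := hNK.lt.trans hKL
  obtain ⟨i, hdepth, hi, hi'⟩ := exists_radDepth (Constituent.of N L hNL.le) hNL.ne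
  change N ⊔ (L ⊓ radPow R M (i + 1)) = N at hi
  change N ⊔ (L ⊓ radPow R M i) ≠ N at hi'
  -- By the modular law N + rad^(i+1) M meets even L only in N, as i + 1 is the radical depth of E.
  have hT : (N ⊔ radPow R M (i + 1)) ⊓ K = N := by
    refine le_antisymm ?_ (le_inf le_sup_left hNK.le)
    calc (N ⊔ radPow R M (i + 1)) ⊓ K ≤ (N ⊔ radPow R M (i + 1)) ⊓ L :=
          inf_le_inf_left _ hKL.le
      _ = N := by rw [sup_inf_assoc_of_le _ hNL.le, inf_comm, hi]
  obtain ⟨X, hTX, hX⟩ := exists_maximal_inf_eq _ _ _ hT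
  have hNX : N ≤ X := le_sup_left.trans hTX
  have hLX : L ⊓ X = N := hsoc _ (le_inf hNL.le hNX) inf_le_left <| by
    rw [inf_assoc, hX.prop, inf_eq_right.2 hNL.le]
  let ι : (K ⧸ N.submoduleOf K) →ₗ[R] M ⧸ X := mapQ _ _ K.subtype fun x hx => hNX hx
  have hι : Function.Injective ι := by
    rw [← LinearMap.ker_eq_bot, eq_bot_iff]
    intro b hb
    obtain ⟨k, rfl⟩ := mkQ_surjective _ b
    have hk : (k : M) ∈ X := (Submodule.Quotient.mk_eq_zero X).1 hb
    exact (Submodule.Quotient.mk_eq_zero _).2 (hX.prop.le ⟨hk, k.2⟩ : (k : M) ∈ N)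
  -- The preimage of U in M contains X and still meets K in N, so it equals X by maximality.
  have hess : ∀ U : Submodule R (M ⧸ X), U ⊓ LinearMap.range ι = ⊥ → U = ⊥ := by
    intro U hU
    have h1 : U.comap X.mkQ ⊓ K = N := by
      refine le_antisymm ?_ (le_inf (hNX.trans (le_comap_mkQ X U)) hNK.le)
      rintro x ⟨hxU, hxK⟩
      have hx : X.mkQ x ∈ U ⊓ LinearMap.range ι := ⟨hxU, mkQ _ ⟨x, hxK⟩, rfl⟩
      rw [hU] at hx
      exact hX.prop.le ⟨(Submodule.Quotient.mk_eq_zero X).1 hx, hxK⟩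
    have h2 := hX.eq_of_ge h1 (le_comap_mkQ X U)
    rw [← map_comap_eq_of_surjective (mkQ_surjective X) U, h2, mkQ_map_self]
  obtain ⟨I, _, _, f, hf, hhull⟩ := exists_isInjectiveHull_of_essential ι hι hess
  have := isSimpleModule_subquotient hNK
  have hind : Indecomposable R (M ⧸ X) :=
    indecomposable_of_isInjectiveHull hhull hf (LinearMap.range_comp_le_range _ _)
  refine ⟨X, ⟨enclosed_quot hNL.le hNL.ne hLX hind, i + 1, hdepth, hasLoewyLength_succ ?_ ?_⟩,
    hLX, I, _, _, f ∘ₗ ι, f, hhull, hf, fun _ => rfl⟩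
  · rw [← map_radPow_of_surjective X.mkQ (mkQ_surjective X), ← LinearMap.le_ker_iff_map, ker_mkQ]
    exact le_sup_right.trans hTX
  · rw [← map_radPow_of_surjective X.mkQ (mkQ_surjective X), Ne, ← LinearMap.le_ker_iff_map, ker_mkQ]
    intro hle
    exact hi' (sup_eq_left.2 (hLX ▸ inf_le_inf_left _ hle))

theorem exists_isCoverSubmodule {N K L : Submodule R M} (hNK : N < K) (hKL : K < L)
    (htop : ∀ Z, N ≤ Z → Z ≤ L → Z ⊔ K = L → Z = L)
    (hcover : HasProjectiveCover R (L ⧸ K.submoduleOf L)) :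
    ∃ Y, IsCoverSubmodule N K L (hNK.trans hKL).le Y := by
  have hNL := hNK.trans hKL
  obtain ⟨i, hdepth, hi, hi'⟩ := exists_socDepth (Constituent.of N L hNL.le) hNL.ne
  change N ⊔ (L ⊓ socPow R M (i + 1)) = L at hi
  change N ⊔ (L ⊓ socPow R M i) ≠ L at hi'
  -- The condition is Y + K = L rather than Y + N = L, so that minimality can be tested on the image
  -- in A; Y + N = L then follows from superfluity of K/N in L/N.
  obtain ⟨Y, ⟨hYle, hYK⟩, hmin⟩ := IsArtinian.set_has_minimal
    {Y : Submodule R M | Y ≤ L ⊓ socPow R M (i + 1) ∧ Y ⊔ K = L}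
    ⟨L ⊓ socPow R M (i + 1), le_rfl, le_antisymm (sup_le inf_le_left hKL.le) <| by
      conv_lhs => rw [← hi]
      exact sup_le (hNK.le.trans le_sup_right) le_sup_left⟩
  replace hmin : ∀ D ≤ Y, D ⊔ K = L → D = Y := fun D hD hDK =>
    hD.eq_of_not_lt (hmin D ⟨hD.trans hYle, hDK⟩)
  have hYL : Y ≤ L := hYle.trans inf_le_left
  have hYN : Y ⊔ N = L := htop _ le_sup_right (sup_le hYL hNL.le) <| by
    rw [sup_assoc, sup_eq_right.2 hNK.le, hYK]
  obtain ⟨P, _, _, p, hp⟩ := hcover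
  have := hp.1
  let q : Y →ₗ[R] L ⧸ K.submoduleOf L := (K.submoduleOf L).mkQ ∘ₗ inclusion hYL
  have hq : ∀ (D : Submodule R M) (hD : D ≤ Y), LinearMap.range (q ∘ₗ inclusion hD) = ⊤ ↔
      D ⊔ K = L := by
    intro D hD
    rw [LinearMap.range_eq_top]
    constructor
    · intro hs
      refine le_antisymm (sup_le (hD.trans hYL) hKL.le) fun x hx => ?_
      obtain ⟨y, hy⟩ := hs (mkQ _ ⟨x, hx⟩)
      have hsub := (Submodule.Quotient.eq _).1 hy.symm
      exact mem_sup.2 ⟨y, y.2, x - y, hsub, by abel⟩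
    · intro h b
      obtain ⟨x, rfl⟩ := mkQ_surjective _ b
      obtain ⟨y, hy, k, hk, hyk⟩ := mem_sup.1 (h ▸ x.2 : (x : M) ∈ D ⊔ K)
      refine ⟨⟨y, hy⟩, ((Submodule.Quotient.eq _).2 ?_).symm⟩
      change (x : M) - y ∈ K
      rwa [← hyk, add_sub_cancel_left]
  have hqs : Function.Surjective q := LinearMap.range_eq_top.1 ((hq Y le_rfl).2 hYK)
  obtain ⟨g, hg⟩ := Module.projective_lifting_property q p hqs
  have hgs : Function.Surjective g := by
    have hle : (LinearMap.range g).map Y.subtype ≤ Y := map_subtype_le _ _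
    have h1 : (LinearMap.range g).map Y.subtype = Y := by
      refine hmin _ hle ((hq _ hle).1 (LinearMap.range_eq_top.2 fun b => ?_))
      obtain ⟨x, rfl⟩ := hp.2.1 b
      exact ⟨⟨g x, g x, ⟨x, rfl⟩, rfl⟩, LinearMap.congr_fun hg x⟩
    rw [← LinearMap.range_eq_top]
    apply map_injective_of_injective Y.injective_subtype
    rw [h1, map_subtype_top]
  refine ⟨Y, ⟨enclosed_sub hNL.le hYN fun D hD hDN => hmin D hD ?_, i + 1, hdepth,
    hasLoewyLength_succ ?_ ?_⟩, hYN, P, _, _, p, g, hYL, hp, hgs, LinearMap.congr_fun hg⟩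
  · exact le_antisymm (sup_le (hD.trans hYL) hKL.le) (hDN ▸ sup_le_sup_left hNK.le D)
  · apply radPow_eq_bot_of_range_le_socPow Y.subtype Y.injective_subtype
    rw [range_subtype]
    exact hYle.trans inf_le_right
  -- Otherwise Y would lie in S_i(M), and L = Y + N would equal N + L ∩ S_i(M), against the socle
  -- depth i + 1.
  · intro h
    have hle := range_le_socPow_of_radPow_eq_bot Y.subtype h
    rw [range_subtype] at hle
    refine hi' (le_antisymm (sup_le hNL.le inf_le_left) ?_)
    conv_lhs => rw [← hYN]
    exact sup_le ((le_inf hYL hle).trans le_sup_right) le_sup_left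

end VirtualExt

theorem mainTheorem5 {R : Type*} [Ring R] {M : Type*} [AddCommGroup M] [Module R M]
    [IsArtinian R M] [IsNoetherian R M]
    (N K L : Submodule R M) (hNK : N < K) (hKL : K < L)
    (hlen : Module.length R (↥L ⧸ N.submoduleOf L) = 2)
    (hind : VirtualExt.Indecomposable R (↥L ⧸ N.submoduleOf L)) :
    ((∃ X : Submodule R M, VirtualExt.IsHullQuotient N K L (hNK.trans hKL).le X ∧
        ∀ X' : Submodule R M, VirtualExt.IsHullQuotient N K L (hNK.trans hKL).le X' →
          VirtualExt.Constituent.Enclosed (.quot X) (.quot X') →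
            VirtualExt.Constituent.VirtEq (.quot X) (.quot X')) ∧
      ∀ X : Submodule R M, VirtualExt.IsHullQuotient N K L (hNK.trans hKL).le X →
        VirtualExt.Indecomposable R (M ⧸ X)) ∧
    ((IsArtinianRing R ∨ VirtualExt.HasProjectiveCover R (↥L ⧸ K.submoduleOf L)) →
      (∃ Y : Submodule R M, VirtualExt.IsCoverSubmodule N K L (hNK.trans hKL).le Y ∧
        ∀ Y' : Submodule R M, VirtualExt.IsCoverSubmodule N K L (hNK.trans hKL).le Y' →
          VirtualExt.Constituent.Enclosed (.sub Y) (.sub Y') →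
            VirtualExt.Constituent.VirtEq (.sub Y) (.sub Y')) ∧
      ∀ Y : Submodule R M, VirtualExt.IsCoverSubmodule N K L (hNK.trans hKL).le Y →
        VirtualExt.Indecomposable R ↥Y) := by
  obtain ⟨hcN, hcK, hsoc, htop⟩ := VirtualExt.uniserial_of_length_two hNK hKL hlen hind
  refine ⟨⟨VirtualExt.Constituent.exists_enclosed_maximal _ _
    (VirtualExt.exists_isHullQuotient hcN hKL hsoc), fun X hX => hX.indecomposable hcN⟩,
    fun hcover => ⟨VirtualExt.Constituent.exists_enclosed_maximal _ _
      (VirtualExt.exists_isCoverSubmodule hNK hKL htop ?_), fun Y hY => hY.indecomposable hcK⟩⟩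
  rcases hcover with hR | hcover
  · have := VirtualExt.isSimpleModule_subquotient hcK
    exact VirtualExt.hasProjectiveCover_of_isArtinianRing _
  · exact hcover
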